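/- Let $X$ be a complex Banach space and $\alpha\ge 0$. For $n\in\mathbb N_0$ put $k^{\beta}(n)=\frac{\Gamma(n+\beta)}{\Gamma(\beta)\Gamma(n+1)}$ for $\beta>0$, and $k^0(0)=1$, $k^0(n)=0$ for $n\ge1$. For a bounded operator $T$ on $X$ with $\mathcal T(n)=T^n$, let $\Delta^{-\alpha}\mathcal T(n)=\sum_{j=0}^n k^{\alpha}(n-j)T^j$; $T$ is called $(C,\alpha)$-bounded if $\sup_{n\ge0}\frac{1}{k^{\alpha+1}(n)}\|\Delta^{-\alpha}\mathcal T(n)\|<\infty$. Let $\{S_\alpha(t)\}_{t\ge0}$ be an $\alpha$-times integrated semigroup of bounded operators on $X$; that is, $t\mapsto S_\alpha(t)x$ is continuous on $[0,\infty)$ for every $x\in X$ and, if $\alpha>0$, $S_\alpha(0)=0$ and $$S_\alpha(t)S_\alpha(s)x=\frac1{\Gamma(\alpha)}\Big(\int_t^{t+s}(t+s-r)^{\alpha-1}S_\alpha(r)x\,dr-\int_0^s(t+s-r)^{\alpha-1}S_\alpha(r)x\,dr\Big),\qquad t,s>0,\ x\in X,$$ while for $\alpha=0$ it is a $C_0$-semigroup.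 Let the closed operator $(A,D(A))$ be its generator: there is $\omega_0\ge0$ such that $\|S_\alpha(t)\|\le Me^{\omega_0t}$ for all $t\ge0$ and some $M$, and such that every $\lambda\in\mathbb C$ with $\Re\lambda>\omega_0$ lies in the resolvent set $\rho(A)$ and satisfies $(\lambda-A)^{-1}x=\lambda^\alpha\int_0^\infty e^{-\lambda t}S_\alpha(t)x\,dt$ for all $x\in X$. (1) Suppose that $\|S_\alpha(t)\|\le Ce^{\omega t}$ for all $t\ge0$, with some constants $C$ and $0\le\omega<1$. Then $1\in\rho(A)$ and, with $R=(1-A)^{-1}$ and $\mathcal R(n)=R^n$, for every $x\in X$ the integrals below converge absolutely, $\int_0^\infty \frac{e^{-t}t^n}{n!}S_\alpha(t)x\,dt\in D(A)$ for every $n\ge 0$, and $$\Delta^{-\alpha}\mathcal R(n)x=(I-A)\int_0^\infty\frac{e^{-t}t^n}{n!}S_\alpha(t)x\,dt,\qquad n\ge0,$$ $$\Delta^{-\alpha}\mathcal R(n)x=\int_0^\infty\frac{e^{-t}t^{n-1}}{(n-1)!}S_\alpha(t)x\,dt+k^{\alpha+1}(n)x-k^{\alpha+1}(n-1)x,\qquad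 n\ge1.$$ (2) Suppose that $\|S_\alpha(t)\|\le Ct^\alpha$ for all $t>0$, with some constant $C$. Then $1\in\rho(A)$ and $(I-A)^{-1}$ is $(C,\alpha)$-bounded. -/

import Mathlib

open Set MeasureTheory

noncomputable section

/-- The Cesàro numbers `k^α(n) = Γ(n+α) / (Γ(α) Γ(n+1))` for `α ≠ 0`, with the limit convention
`k^0 = (1, 0, 0, …)` (the coefficients of `(1 - z)^(-α)`). -/
def cesaroNumber (α : ℝ) (n : ℕ) : ℝ :=
  if α = 0 then (if n = 0 then 1 else 0)
  else Real.Gamma (n + α) / (Real.Gamma α * Real.Gamma (n + 1))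

section Operators

variable {X : Type*} [NormedAddCommGroup X] [NormedSpace ℂ X]

/-- The Cesàro sum of order `α` of the powers of `T`: `∑_{j=0}^n k^α(n-j) T^j`. -/
def cesaroSum (α : ℝ) (T : X →L[ℂ] X) (n : ℕ) : X →L[ℂ] X :=
  ∑ j ∈ Finset.range (n + 1), ((cesaroNumber α (n - j) : ℝ) : ℂ) • T ^ j

/-- `T` is `(C, α)`-bounded: `sup_n ‖k^{α+1}(n)⁻¹ Δ^{-α}𝒯(n)‖ < ∞`. -/
def IsCesaroBounded (α : ℝ) (T : X →L[ℂ] X) : Prop :=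
  BddAbove (range fun n : ℕ => ‖((1 / cesaroNumber (α + 1) n : ℝ) : ℂ) • cesaroSum α T n‖)

/-- The bounded operator `R` is the two-sided inverse of `z - A : D(A) → X`. -/
def IsResolventAt (A : X →ₗ.[ℂ] X) (z : ℂ) (R : X →L[ℂ] X) : Prop :=
  (∀ x : X, ∃ h : R x ∈ A.domain, z • R x - A ⟨R x, h⟩ = x) ∧
    ∀ x : A.domain, R (z • (x : X) - A x) = x

/-- The resolvent set `ρ(A)` of a (possibly unbounded) operator. -/
def opResolventSet (A : X →ₗ.[ℂ] X) : Set ℂ :=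
  {z | ∃ R : X →L[ℂ] X, IsResolventAt A z R}

open Classical in
/-- The resolvent `(z - A)⁻¹`, for `z ∈ ρ(A)` (and `0` elsewhere). -/
def opResolvent (A : X →ₗ.[ℂ] X) (z : ℂ) : X →L[ℂ] X :=
  if h : z ∈ opResolventSet A then h.choose else 0

/-- On the resolvent set, `opResolvent` is the inverse of `z - A`. -/
theorem isResolventAt_opResolvent {A : X →ₗ.[ℂ] X} {z : ℂ} (h : z ∈ opResolventSet A) :
    IsResolventAt A z (opResolvent A z) := by
  unfold opResolvent
  rw [dif_pos h]
  exact h.choose_spec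

/-- The family `S(t)`, `t ≥ 0`, is an `α`-times integrated semigroup (`α ≥ 0`); only the values of
`S` on `[0, ∞)` matter. For `α = 0` this is a `C₀`-semigroup. -/
structure IsIntegratedSemigroup (α : ℝ) (S : ℝ → X →L[ℂ] X) : Prop where
  continuousOn : ∀ x : X, ContinuousOn (fun t => S t x) (Ici 0)
  zero_of_eq : α = 0 → S 0 = 1
  add_of_eq : α = 0 → ∀ t > 0, ∀ s > 0, S (t + s) = S t * S s
  zero_of_pos : 0 < α → S 0 = 0
  mul_of_pos : 0 < α → ∀ t > 0, ∀ s > 0, ∀ x : X,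
    S t (S s x) = ((1 / Real.Gamma α : ℝ) : ℂ) •
      ((∫ r in t..(t + s), (((t + s - r) ^ (α - 1) : ℝ) : ℂ) • S r x) -
        ∫ r in (0 : ℝ)..s, (((t + s - r) ^ (α - 1) : ℝ) : ℂ) • S r x)

/-- The closed operator `A` is the generator of the family `S`: `S` is exponentially bounded, and
for all `z` in some right half-plane, `z ∈ ρ(A)` and `(z - A)⁻¹ x = z^α ∫_0^∞ e^{-zt} S(t)x dt`.
(Injectivity of the resolvent makes `S` non-degenerate.) -/
structure IsGeneratorOf (A : X →ₗ.[ℂ] X) (α : ℝ) (S : ℝ → X →L[ℂ] X) : Prop where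
  isClosed : A.IsClosed
  laplace : ∃ ω₀ : ℝ, 0 ≤ ω₀ ∧ (∃ M : ℝ, ∀ t ≥ 0, ‖S t‖ ≤ M * Real.exp (ω₀ * t)) ∧
    ∀ z : ℂ, ω₀ < z.re → z ∈ opResolventSet A ∧
      ∀ x : X, opResolvent A z x =
        z ^ (α : ℂ) • ∫ t in Ioi (0 : ℝ), Complex.exp (-z * t) • S t x

/-- The function `t ↦ e^{-t} t^n / n! · S(t)x`. -/
def laplaceIntegrand (S : ℝ → X →L[ℂ] X) (n : ℕ) (x : X) (t : ℝ) : X :=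
  ((Real.exp (-t) * t ^ n / n.factorial : ℝ) : ℂ) • S t x

end Operators

end

/-! ### Cesàro numbers and uniqueness of power series coefficients. -/

open Filter Topology

/-! Let `F(z) = ∫ e^{-zt} S(t) dt`. Since `F(z) = z^{-α} (z - A)⁻¹` far to the right, analytic
continuation of the resolvent identities gives this on all of `Re z > ω`
(`IsGeneratorOf.isResolventAt`), in particular near `1`. The integrals `L n` in the theorem are the
coefficients of `F(1 - w)` in powers of `w`. The resolvent identity reads `F(1 - w) = (1 - w)^{-α} R
+ w F(1 - w) R`; comparing coefficients, `L n = k^α(n) R + L (n-1) R`, so `L n = R Δ^{-α}𝓡(n)`.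
Applying `I - A` gives the first formula; `Δ^{-α}𝓡(n+1) = k^α(n+1) + Δ^{-α}𝓡(n) R` gives the second.
For (2), a Gamma integral bounds `L n` by a multiple of `k^{α+1}(n)`. -/

theorem cesaroNumber_eq_ascPochhammer {α : ℝ} (hα : 0 ≤ α) (n : ℕ) :
    cesaroNumber α n = (ascPochhammer ℝ n).eval α / n.factorial := by
  rcases hα.eq_or_lt with rfl | hα
  · simp only [cesaroNumber, if_true, ascPochhammer_eval_zero]
    split_ifs with h <;> simp [h]
  · rw [cesaroNumber, if_neg hα.ne', Real.Gamma_nat_eq_factorial, ← div_div]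
    congr 1
    rw [div_eq_iff (Real.Gamma_pos_of_pos hα).ne']
    induction n with
    | zero => simp
    | succ n ih =>
      rw [ascPochhammer_succ_eval, Nat.cast_succ, show (n : ℝ) + 1 + α = (n + α) + 1 by ring,
        Real.Gamma_add_one (by positivity), ih]
      ring

theorem cesaroNumber_zero {α : ℝ} (hα : 0 ≤ α) : cesaroNumber α 0 = 1 := by
  simp [cesaroNumber_eq_ascPochhammer hα]

theorem cesaroNumber_nonneg {α : ℝ} (hα : 0 ≤ α) (n : ℕ) : 0 ≤ cesaroNumber α n := by
  rw [cesaroNumber_eq_ascPochhammer hα]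
  refine div_nonneg ?_ (Nat.cast_nonneg _)
  rcases hα.eq_or_lt with rfl | h
  · rw [ascPochhammer_eval_zero]; split_ifs <;> norm_num
  · exact (ascPochhammer_pos n α h).le

theorem cesaroNumber_add_one_pos {α : ℝ} (hα : 0 ≤ α) (n : ℕ) : 0 < cesaroNumber (α + 1) n := by
  rw [cesaroNumber_eq_ascPochhammer (by linarith)]
  exact div_pos (ascPochhammer_pos n _ (by linarith)) (by positivity)

theorem ascPochhammer_eval_succ_left (α : ℝ) (n : ℕ) :
    (ascPochhammer ℝ (n + 1)).eval α = α * (ascPochhammer ℝ n).eval (α + 1) := by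
  simp [ascPochhammer_succ_left, Polynomial.eval_comp]

/-- Coefficientwise form of `(1 - z) (1 - z)^{-(α+1)} = (1 - z)^{-α}`. -/
theorem cesaroNumber_add_one_sub {α : ℝ} (hα : 0 ≤ α) (n : ℕ) :
    cesaroNumber (α + 1) (n + 1) - cesaroNumber (α + 1) n = cesaroNumber α (n + 1) := by
  rw [cesaroNumber_eq_ascPochhammer hα, cesaroNumber_eq_ascPochhammer (by linarith),
    cesaroNumber_eq_ascPochhammer (by linarith), ascPochhammer_eval_succ_left α n,
    ascPochhammer_succ_eval, Nat.factorial_succ]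
  have : (n.factorial : ℝ) ≠ 0 := by positivity
  push_cast
  field_simp
  ring

theorem hasSum_cesaroNumber {α : ℝ} (hα : 0 ≤ α) :
    ∀ᶠ w in 𝓝 (0 : ℂ),
      HasSum (fun n : ℕ => w ^ n • ((cesaroNumber α n : ℝ) : ℂ)) ((1 - w) ^ (α : ℂ))⁻¹ := by
  have h := hasFPowerSeriesAt_iff.1
    (Complex.one_div_one_sub_cpow_hasFPowerSeriesOnBall_zero (α : ℂ)).hasFPowerSeriesAt
  filter_upwards [h] with w hw
  simp only [zero_add, one_div, FormalMultilinearSeries.coeff_ofScalars] at hw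
  convert! hw using 2 with n
  congr 1
  rw [← Ring.multichoose_eq, cesaroNumber_eq_ascPochhammer hα]
  have h := Ring.factorial_nsmul_multichoose_eq_ascPochhammer (α : ℂ) n
  rw [Polynomial.ascPochhammer_smeval_eq_eval, nsmul_eq_mul] at h
  have h2 : (((ascPochhammer ℝ n).eval α : ℝ) : ℂ) = (ascPochhammer ℂ n).eval (α : ℂ) := by
    rw [← ascPochhammer_map Complex.ofRealHom, Polynomial.eval_map]
    exact (Polynomial.eval₂_at_apply Complex.ofRealHom α).symm
  rw [Complex.ofReal_div, h2, ← h, Complex.ofReal_natCast,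
    mul_div_cancel_left₀ _ (by exact_mod_cast n.factorial_ne_zero)]

/-- The power series on `ℂ` with prescribed vector coefficients. -/
noncomputable def vectorSeries {X : Type*} [NormedAddCommGroup X] [NormedSpace ℂ X] (a : ℕ → X) :
    FormalMultilinearSeries ℂ ℂ X :=
  fun n => ContinuousMultilinearMap.mkPiRing ℂ (Fin n) (a n)

@[simp]
theorem coeff_vectorSeries {X : Type*} [NormedAddCommGroup X] [NormedSpace ℂ X] (a : ℕ → X)
    (n : ℕ) : (vectorSeries a).coeff n = a n := by
  simp [FormalMultilinearSeries.coeff, vectorSeries]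

theorem coeff_eq_of_hasSum {X : Type*} [NormedAddCommGroup X] [NormedSpace ℂ X]
    {a b : ℕ → X} {f : ℂ → X}
    (ha : ∀ᶠ w in 𝓝 (0 : ℂ), HasSum (fun n => w ^ n • a n) (f w))
    (hb : ∀ᶠ w in 𝓝 (0 : ℂ), HasSum (fun n => w ^ n • b n) (f w)) : a = b := by
  have key : ∀ c : ℕ → X, (∀ᶠ w in 𝓝 (0 : ℂ), HasSum (fun n => w ^ n • c n) (f w)) →
      HasFPowerSeriesAt f (vectorSeries c) 0 := by
    intro c hc
    rw [hasFPowerSeriesAt_iff]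
    simpa using hc
  have h := (key a ha).eq_formalMultilinearSeries (key b hb)
  funext n
  simpa using congrArg (fun p : FormalMultilinearSeries ℂ ℂ X => p.coeff n) h

/-! ### Resolvent identities. -/

section Resolvent

variable {X : Type*} [NormedAddCommGroup X] [NormedSpace ℂ X] {A : X →ₗ.[ℂ] X}

theorem IsResolventAt.eq {z : ℂ} {R R' : X →L[ℂ] X} (h : IsResolventAt A z R)
    (h' : IsResolventAt A z R') : R = R' := by
  ext x
  obtain ⟨hx, e⟩ := h.1 x
  have := h'.2 ⟨R x, hx⟩
  rw [e] at this
  exact this.symm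

/-- Apply `R` to `(μ - A) Q x = x + (μ - z) Q x`. -/
theorem IsResolventAt.sub_apply {z μ : ℂ} {R Q : X →L[ℂ] X} (hR : IsResolventAt A μ R)
    (hQ : IsResolventAt A z Q) (x : X) : Q x = R x + (μ - z) • R (Q x) := by
  obtain ⟨hx, e⟩ := hQ.1 x
  have h := hR.2 ⟨Q x, hx⟩
  have : μ • Q x - A ⟨Q x, hx⟩ = x + (μ - z) • Q x := by
    have e' : z • Q x = x + A ⟨Q x, hx⟩ := sub_eq_iff_eq_add.1 e
    rw [sub_smul, e']; abel
  simp only [this, map_add, map_smul] at h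
  exact h.symm

/-- The first identity puts the range of `Q` in the domain and makes `Q` a right inverse; the second
makes it a left inverse. Thus being a resolvent reduces to equations that continue analytically in
`z`. -/
theorem IsResolventAt.of_eq {z μ : ℂ} {R Q : X →L[ℂ] X} (hR : IsResolventAt A μ R)
    (h₁ : ∀ x, Q x = R x + (μ - z) • R (Q x)) (h₂ : ∀ x, Q x = R x + (μ - z) • Q (R x)) :
    IsResolventAt A z Q := by
  constructor
  · intro x
    obtain ⟨hx, e⟩ := hR.1 (x + (μ - z) • Q x)
    have hQ : R (x + (μ - z) • Q x) = Q x := by rw [map_add, map_smul, ← h₁]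
    simp only [hQ] at hx e
    refine ⟨hx, ?_⟩
    replace e : μ • Q x - A ⟨Q x, hx⟩ = x + (μ • Q x - z • Q x) := by rw [e, sub_smul]
    have : z • Q x - A ⟨Q x, hx⟩ = (μ • Q x - A ⟨Q x, hx⟩) - (μ • Q x - z • Q x) := by abel
    rw [this, e]; abel
  · intro x
    have e := hR.2 x
    have h := h₂ (μ • (x : X) - A x)
    rw [e] at h
    have : z • (x : X) - A x = (μ • (x : X) - A x) - (μ - z) • (x : X) := by
      rw [sub_smul]; abel
    rw [this, map_sub, map_smul, h]; abel

end Resolvent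

/-! ### Convergence and analyticity of the Laplace transform. -/

section Laplace

variable {X : Type*} [NormedAddCommGroup X] [NormedSpace ℂ X]
  {S : ℝ → X →L[ℂ] X} {C ω : ℝ}

/-- The function `t ↦ e^{-zt} t^n / n! · S(t)x`, whose integral is, up to sign, a Taylor
coefficient of the Laplace transform at `z`. -/
noncomputable def laplaceKernel (S : ℝ → X →L[ℂ] X) (z : ℂ) (n : ℕ) (x : X) (t : ℝ) : X :=
  (Complex.exp (-z * t) * ((t ^ n / n.factorial : ℝ) : ℂ)) • S t x

theorem laplaceKernel_one (n : ℕ) (x : X) : laplaceKernel S 1 n x = laplaceIntegrand S n x := by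
  funext t
  simp only [laplaceKernel, laplaceIntegrand]
  push_cast
  rw [neg_one_mul, mul_div_assoc]

theorem laplaceKernel_zero (z : ℂ) (x : X) (t : ℝ) :
    laplaceKernel S z 0 x t = Complex.exp (-z * t) • S t x := by
  simp [laplaceKernel]

theorem aestronglyMeasurable_laplaceKernel (hS : ∀ x, ContinuousOn (fun t => S t x) (Ici 0))
    (z : ℂ) (n : ℕ) (x : X) :
    AEStronglyMeasurable (laplaceKernel S z n x) (volume.restrict (Ioi 0)) := by
  refine ContinuousOn.aestronglyMeasurable ?_ measurableSet_Ioi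
  exact (Continuous.continuousOn (by fun_prop)).smul ((hS x).mono Ioi_subset_Ici_self)

theorem norm_laplaceKernel_le (hb : ∀ t ≥ 0, ‖S t‖ ≤ C * Real.exp (ω * t)) (z : ℂ) (n : ℕ)
    (x : X) {t : ℝ} (ht : 0 ≤ t) :
    ‖laplaceKernel S z n x t‖ ≤
      t ^ n / n.factorial * (C * Real.exp (-(z.re - ω) * t) * ‖x‖) := by
  rw [laplaceKernel, norm_smul, norm_mul, Complex.norm_exp, Complex.norm_real,
    Real.norm_of_nonneg (by positivity)]
  have h1 : ‖S t x‖ ≤ C * Real.exp (ω * t) * ‖x‖ := (S t).le_of_opNorm_le (hb t ht) x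
  have h2 : (-z * t : ℂ).re = -z.re * t := by simp
  rw [h2]
  calc _ ≤ Real.exp (-z.re * t) * (t ^ n / n.factorial) * (C * Real.exp (ω * t) * ‖x‖) := by
        gcongr
    _ = t ^ n / n.factorial * (C * (Real.exp (-z.re * t) * Real.exp (ω * t)) * ‖x‖) := by ring
    _ = _ := by rw [← Real.exp_add]; ring_nf

theorem integrableOn_pow_mul_exp (n : ℕ) {b : ℝ} (hb : 0 < b) :
    IntegrableOn (fun t : ℝ => t ^ n * Real.exp (-b * t)) (Ioi 0) := by
  have := integrableOn_rpow_mul_exp_neg_mul_rpow (p := 1) (s := n) (b := b)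
    (by have : (0 : ℝ) ≤ n := n.cast_nonneg
        linarith) one_pos hb
  simpa using this

theorem integrableOn_laplaceKernel (hS : ∀ x, ContinuousOn (fun t => S t x) (Ici 0))
    (hb : ∀ t ≥ 0, ‖S t‖ ≤ C * Real.exp (ω * t)) {z : ℂ} (hz : ω < z.re) (n : ℕ) (x : X) :
    IntegrableOn (laplaceKernel S z n x) (Ioi 0) := by
  refine Integrable.mono'
    (((integrableOn_pow_mul_exp n (sub_pos.2 hz)).mul_const (C * ‖x‖ / n.factorial)))
    (aestronglyMeasurable_laplaceKernel hS z n x) ?_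
  filter_upwards [ae_restrict_mem measurableSet_Ioi] with t ht
  refine (norm_laplaceKernel_le hb z n x (le_of_lt ht)).trans_eq ?_
  ring

/-- Expand `e^{wt}` under the integral; the norms of the terms sum to at most a multiple of `e^{-(Re
z - ω - ‖w‖) t}`, which is integrable. -/
theorem hasSum_integral_laplaceKernel (hS : ∀ x, ContinuousOn (fun t => S t x) (Ici 0))
    (hb : ∀ t ≥ 0, ‖S t‖ ≤ C * Real.exp (ω * t)) {z w : ℂ} (hw : ‖w‖ < z.re - ω) (x : X) :
    HasSum (fun n => w ^ n • ∫ t in Ioi (0 : ℝ), laplaceKernel S z n x t)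
      (∫ t in Ioi (0 : ℝ), laplaceKernel S (z - w) 0 x t) := by
  simp_rw [← integral_smul]
  have hexp (t : ℝ) : HasSum (fun n : ℕ => ‖w‖ ^ n *
      (t ^ n / n.factorial * (C * Real.exp (-(z.re - ω) * t) * ‖x‖)))
      (C * ‖x‖ * Real.exp (-(z.re - ω - ‖w‖) * t)) := by
    have h := (NormedSpace.expSeries_div_hasSum_exp (𝔸 := ℝ) (‖w‖ * t)).mul_right
      (C * Real.exp (-(z.re - ω) * t) * ‖x‖)
    rw [← Real.exp_eq_exp_ℝ] at h
    convert! h using 1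
    · funext n; simp only [mul_pow]; ring
    · rw [show -(z.re - ω - ‖w‖) * t = ‖w‖ * t + -(z.re - ω) * t by ring, Real.exp_add]; ring
  refine hasSum_integral_of_dominated_convergence
    (fun n t => ‖w‖ ^ n * (t ^ n / n.factorial * (C * Real.exp (-(z.re - ω) * t) * ‖x‖)))
    (fun n => (aestronglyMeasurable_laplaceKernel hS z n x).const_smul _) ?_
    (.of_forall fun t => (hexp t).summable) ?_ (.of_forall fun t => ?_)
  · intro n
    filter_upwards [ae_restrict_mem measurableSet_Ioi] with t ht
    rw [norm_smul, norm_pow]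
    exact mul_le_mul_of_nonneg_left (norm_laplaceKernel_le hb z n x (le_of_lt ht)) (by positivity)
  · simp_rw [fun t => (hexp t).tsum_eq]
    simpa using ((integrableOn_pow_mul_exp 0 (sub_pos.2 hw)).const_mul (C * ‖x‖))
  · have h := ((NormedSpace.expSeries_div_hasSum_exp (𝔸 := ℂ) (w * t)).mul_left
      (Complex.exp (-z * t))).smul_const (S t x)
    rw [← Complex.exp_eq_exp_ℂ, ← Complex.exp_add] at h
    convert h using 1
    · funext n
      rw [laplaceKernel, smul_smul]
      congr 1
      push_cast
      rw [mul_pow]; ring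
    · rw [laplaceKernel_zero]
      congr 2; ring

theorem analyticAt_integral_laplaceKernel (hS : ∀ x, ContinuousOn (fun t => S t x) (Ici 0))
    (hb : ∀ t ≥ 0, ‖S t‖ ≤ C * Real.exp (ω * t)) {z : ℂ} (hz : ω < z.re) (x : X) :
    AnalyticAt ℂ (fun z => ∫ t in Ioi (0 : ℝ), laplaceKernel S z 0 x t) z := by
  refine ⟨vectorSeries fun n =>
    (-1 : ℂ) ^ n • ∫ t in Ioi (0 : ℝ), laplaceKernel S z n x t, ?_⟩
  rw [hasFPowerSeriesAt_iff]
  filter_upwards [Metric.ball_mem_nhds (0 : ℂ) (sub_pos.2 hz)] with w hw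
  have h := hasSum_integral_laplaceKernel hS hb (z := z) (w := -w) (by simpa using hw) x
  rw [sub_neg_eq_add] at h
  convert h using 1
  funext n
  rw [coeff_vectorSeries, smul_smul]
  rw [neg_pow w, mul_comm]

/-- Multiples of the Laplace transform `x ↦ c ∫_0^∞ e^{-zt} S(t)x dt` are bounded operators. -/
theorem exists_laplace_clm (hS : ∀ x, ContinuousOn (fun t => S t x) (Ici 0))
    (hb : ∀ t ≥ 0, ‖S t‖ ≤ C * Real.exp (ω * t)) {z : ℂ} (hz : ω < z.re) (c : ℂ) :
    ∃ Q : X →L[ℂ] X, ∀ x, Q x = c • ∫ t in Ioi (0 : ℝ), laplaceKernel S z 0 x t := by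
  let Q₀ : X →ₗ[ℂ] X :=
    { toFun := fun x => c • ∫ t in Ioi (0 : ℝ), laplaceKernel S z 0 x t
      map_add' := fun x y => by
        rw [← smul_add, ← integral_add (integrableOn_laplaceKernel hS hb hz 0 x)
          (integrableOn_laplaceKernel hS hb hz 0 y)]
        simp [laplaceKernel]
      map_smul' := fun a x => by
        rw [RingHom.id_apply, smul_comm a, ← integral_smul a]
        simp only [laplaceKernel, map_smul, smul_comm a] }
  refine ⟨Q₀.mkContinuous
    (‖c‖ * ∫ t in Ioi (0 : ℝ), C * Real.exp (-(z.re - ω) * t)) fun x => ?_, fun x => rfl⟩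
  change ‖c • ∫ t in Ioi (0 : ℝ), laplaceKernel S z 0 x t‖ ≤ _
  rw [norm_smul, mul_assoc, ← integral_mul_const]
  refine mul_le_mul_of_nonneg_left (norm_integral_le_of_norm_le ?_ ?_) (norm_nonneg c)
  · simpa using ((integrableOn_pow_mul_exp 0 (sub_pos.2 hz)).const_mul C).mul_const ‖x‖
  · filter_upwards [ae_restrict_mem measurableSet_Ioi] with t ht
    simpa using norm_laplaceKernel_le hb z 0 x (le_of_lt ht)

end Laplace

/-! ### Continuation of the resolvent, moments and growth bounds. -/

section Generator

variable {X : Type*} [NormedAddCommGroup X] [NormedSpace ℂ X]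
  {A : X →ₗ.[ℂ] X} {α : ℝ} {S : ℝ → X →L[ℂ] X} {C ω : ℝ}

/-- The Laplace representation of the resolvent extends analytically to every half-plane
`Re z > ω ≥ 0` on which the Laplace integral converges by exponential boundedness. -/
theorem IsGeneratorOf.isResolventAt [CompleteSpace X] (hA : IsGeneratorOf A α S)
    (hS : ∀ x, ContinuousOn (fun t => S t x) (Ici 0)) (hω : 0 ≤ ω)
    (hb : ∀ t ≥ 0, ‖S t‖ ≤ C * Real.exp (ω * t)) {z : ℂ} (hz : ω < z.re) :
    z ∈ opResolventSet A ∧ ∀ x, opResolvent A z x =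
      z ^ (α : ℂ) • ∫ t in Ioi (0 : ℝ), laplaceKernel S z 0 x t := by
  obtain ⟨ω₀, -, -, hres⟩ := hA.laplace
  simp_rw [← laplaceKernel_zero] at hres
  set U : Set ℂ := {z | ω < z.re}
  set Q : X → ℂ → X := fun x z => z ^ (α : ℂ) • ∫ t in Ioi (0 : ℝ), laplaceKernel S z 0 x t
  have hQ (x : X) : AnalyticOnNhd ℂ (Q x) U := fun z (hz : ω < z.re) =>
    (analyticAt_id.cpow analyticAt_const (Or.inl (hω.trans_lt hz))).smul
      (analyticAt_integral_laplaceKernel hS hb hz x)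
  have hconv : IsPreconnected U := (convex_halfSpace_re_gt ω).isPreconnected
  -- A base point in both half-planes `Re z > ω` and `Re z > ω₀`.
  set μ : ℂ := ((max ω ω₀ + 1 : ℝ) : ℂ) with hμ
  have hμre : max ω ω₀ < μ.re := by simp [hμ]
  have hμU : μ ∈ U := (le_max_left _ _).trans_lt hμre
  have hev : ∀ᶠ z in 𝓝 μ, ω₀ < z.re :=
    (isOpen_lt continuous_const Complex.continuous_re).mem_nhds
      ((le_max_right _ _).trans_lt hμre)
  set R := opResolvent A μ
  have hR : IsResolventAt A μ R := isResolventAt_opResolvent (hres μ hev.self_of_nhds).1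
  have hnear : ∀ᶠ z in 𝓝 μ, IsResolventAt A z (opResolvent A z) ∧
      ∀ x, opResolvent A z x = Q x z :=
    hev.mono fun z hz => ⟨isResolventAt_opResolvent (hres z hz).1, (hres z hz).2⟩
  have hlin : AnalyticOnNhd ℂ (fun z : ℂ => μ - z) U := fun z _ => by fun_prop
  have h₁ (x : X) : EqOn (Q x) (fun z => R x + (μ - z) • R (Q x z)) U := by
    refine (hQ x).eqOn_of_preconnected_of_eventuallyEq
      (analyticOnNhd_const.add (hlin.smul (R.comp_analyticOnNhd (hQ x)))) hconv hμU ?_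
    filter_upwards [hnear] with z hz
    rw [← hz.2]
    exact hR.sub_apply hz.1 x
  have h₂ (x : X) : EqOn (Q x) (fun z => R x + (μ - z) • Q (R x) z) U := by
    refine (hQ x).eqOn_of_preconnected_of_eventuallyEq
      (analyticOnNhd_const.add (hlin.smul (hQ (R x)))) hconv hμU ?_
    filter_upwards [hnear] with z hz
    -- The resolvent identity with the roles of `z` and `μ` exchanged.
    have h : R x = opResolvent A z x + (z - μ) • opResolvent A z (R x) := hz.1.sub_apply hR x
    rw [← hz.2, ← hz.2, eq_sub_of_add_eq h.symm, ← neg_sub μ z]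
    module
  obtain ⟨T, hT⟩ := exists_laplace_clm hS hb hz (z ^ (α : ℂ))
  have hTr : IsResolventAt A z T := by
    refine hR.of_eq (fun x => ?_) (fun x => ?_)
    · rw [hT]; exact h₁ x hz
    · rw [hT, hT]; exact h₂ x hz
  have hmem : z ∈ opResolventSet A := ⟨T, hTr⟩
  refine ⟨hmem, fun x => ?_⟩
  rw [(isResolventAt_opResolvent hmem).eq hTr, hT]

theorem cesaroSum_zero (hα : 0 ≤ α) (T : X →L[ℂ] X) : cesaroSum α T 0 = 1 := by
  simp [cesaroSum, cesaroNumber_zero hα]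

theorem cesaroSum_succ (T : X →L[ℂ] X) (n : ℕ) :
    cesaroSum α T (n + 1) = ((cesaroNumber α (n + 1) : ℝ) : ℂ) • 1 + cesaroSum α T n * T := by
  rw [cesaroSum, Finset.sum_range_succ', cesaroSum, Finset.sum_mul, add_comm]
  simp [pow_succ]

theorem commute_cesaroSum (T : X →L[ℂ] X) (n : ℕ) : Commute T (cesaroSum α T n) :=
  Commute.sum_right _ _ _ fun _ _ => ((Commute.refl T).pow_right _).smul_right _

/-- The moments `∫ e^{-t} t^n / n! S(t)x dt` are the Taylor coefficients at `1` of
`z^{-α} (z - A)⁻¹`, hence equal to `(1 - A)⁻¹` applied to the Cesàro sums of `(1 - A)⁻¹`. -/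
theorem IsGeneratorOf.integral_laplaceIntegrand [CompleteSpace X] (hα : 0 ≤ α) (hA : IsGeneratorOf A α S)
    (hS : ∀ x, ContinuousOn (fun t => S t x) (Ici 0)) (hω : 0 ≤ ω) (hω1 : ω < 1)
    (hb : ∀ t ≥ 0, ‖S t‖ ≤ C * Real.exp (ω * t)) (n : ℕ) (x : X) :
    ∫ t in Ioi (0 : ℝ), laplaceIntegrand S n x t =
      opResolvent A 1 (cesaroSum α (opResolvent A 1) n x) := by
  set R := opResolvent A 1
  have hR : IsResolventAt A 1 R :=
    isResolventAt_opResolvent (hA.isResolventAt hS hω hb (by simpa using hω1)).1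
  set L : ℕ → X → X := fun n x => ∫ t in Ioi (0 : ℝ), laplaceIntegrand S n x t with hL
  have hsum (x : X) : ∀ᶠ w in 𝓝 (0 : ℂ), HasSum (fun n => w ^ n • L n x)
      (∫ t in Ioi (0 : ℝ), laplaceKernel S (1 - w) 0 x t) := by
    filter_upwards [Metric.ball_mem_nhds (0 : ℂ) (sub_pos.2 hω1)] with w hw
    simp only [hL, ← laplaceKernel_one]
    exact hasSum_integral_laplaceKernel hS hb (by simpa using hw) x
  -- Both sides are coefficients of `F(1 - w) x`; multiplication by `w` shifts the index.
  have hrec (x : X) : (fun n => L n x) = fun n => ((cesaroNumber α n : ℝ) : ℂ) • R x +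
      (match n with | 0 => 0 | n + 1 => L n (R x)) := by
    refine coeff_eq_of_hasSum (hsum x) ?_
    filter_upwards [hsum (R x), hasSum_cesaroNumber hα,
      Metric.ball_mem_nhds (0 : ℂ) (sub_pos.2 hω1)] with w h1 h2 hw
    have hre : ω < (1 - w).re := by
      have := (Complex.re_le_norm w).trans_lt (by simpa using hw)
      simp only [Complex.sub_re, Complex.one_re]
      linarith
    obtain ⟨hmem, hQ⟩ := hA.isResolventAt hS hω hb hre
    have hne : (1 - w) ^ (α : ℂ) ≠ 0 := by
      rw [Complex.cpow_ne_zero_iff]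
      left
      intro h0
      rw [h0] at hre
      exact absurd hre (by simpa using hω)
    have hinv (y : X) : ∫ t in Ioi (0 : ℝ), laplaceKernel S (1 - w) 0 y t =
        ((1 - w) ^ (α : ℂ))⁻¹ • opResolvent A (1 - w) y := by
      rw [hQ, inv_smul_smul₀ hne]
    have h3 := (isResolventAt_opResolvent hmem).sub_apply hR x
    have hshift : HasSum (fun n : ℕ => w ^ n • (match n with | 0 => (0 : X) | n + 1 => L n (R x)))
        (w • ∫ t in Ioi (0 : ℝ), laplaceKernel S (1 - w) 0 (R x) t) := by
      rw [← hasSum_nat_add_iff' 1]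
      simpa [pow_succ', mul_smul] using h1.const_smul w
    convert (h2.smul_const (R x)).add hshift using 1
    · funext n
      rw [smul_add, smul_assoc]
    · rw [hinv, hinv, smul_comm w, ← smul_add]
      congr 1
      rw [sub_sub_cancel_left] at h3
      rw [eq_sub_of_add_eq h3.symm]
      module
  change L n x = _
  induction n generalizing x with
  | zero =>
    rw [congrFun (hrec x) 0, cesaroSum_zero hα, cesaroNumber_zero hα]
    simp
  | succ n ih =>
    rw [congrFun (hrec x) (n + 1), cesaroSum_succ]
    simp [ih (R x)]

/-- `∫ e^{-t} t^{n+α} / n! dt = Γ(n+α+1) / n! = Γ(α+1) k^{α+1}(n)`. -/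
theorem norm_integral_laplaceIntegrand_le (hα : 0 ≤ α) (hC : ∀ t > 0, ‖S t‖ ≤ C * t ^ α)
    (n : ℕ) (x : X) :
    ‖∫ t in Ioi (0 : ℝ), laplaceIntegrand S n x t‖ ≤
      C * Real.Gamma (α + 1) * cesaroNumber (α + 1) n * ‖x‖ := by
  have hint : IntegrableOn (fun t : ℝ => C * ‖x‖ / n.factorial *
      (Real.exp (-t) * t ^ (α + 1 + n - 1))) (Ioi 0) :=
    (Real.GammaIntegral_convergent (by positivity)).const_mul _
  refine (norm_integral_le_of_norm_le hint ?_).trans_eq ?_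
  · filter_upwards [ae_restrict_mem measurableSet_Ioi] with t ht
    have ht : 0 < t := ht
    rw [laplaceIntegrand, norm_smul, Complex.norm_real, Real.norm_of_nonneg (by positivity),
      show α + 1 + n - 1 = α + n by ring, Real.rpow_add ht, Real.rpow_natCast]
    calc _ ≤ Real.exp (-t) * t ^ n / n.factorial * (C * t ^ α * ‖x‖) := by
          gcongr
          exact (S t).le_of_opNorm_le (hC t ht) x
      _ = _ := by ring
  · rw [integral_const_mul, ← Real.Gamma_eq_integral (by positivity), cesaroNumber,
      if_neg (by positivity), Real.Gamma_nat_eq_factorial, add_comm (n : ℝ)]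
    have := (Real.Gamma_pos_of_pos (show 0 < α + 1 by positivity)).ne'
    field_simp

/-- Polynomial growth of order `α` gives exponential boundedness of any positive type. -/
theorem exists_norm_le_exp_of_rpow (hα : 0 ≤ α) (hC : ∀ t > 0, ‖S t‖ ≤ C * t ^ α) :
    ∃ C' : ℝ, ∀ t ≥ 0, ‖S t‖ ≤ C' * Real.exp (1 / 2 * t) := by
  have hC0 : 0 ≤ C := by simpa using (norm_nonneg _).trans (hC 1 one_pos)
  -- The power bound says nothing at `t = 0`, hence `‖S 0‖`. For `t > 0`, raise `s ≤ e^s` with `s =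
  -- t / (2(α+1))` to the power `α`; the rate is `α / (2(α+1)) ≤ 1/2`.
  refine ⟨max ‖S 0‖ (C * ((α + 1) * 2) ^ α), fun t ht => ?_⟩
  rcases ht.lt_or_eq' with ht | rfl
  · have h1 : t ≤ (α + 1) * 2 * Real.exp (t / ((α + 1) * 2)) := by
      have h := Real.add_one_le_exp (t / ((α + 1) * 2))
      rw [← div_le_iff₀' (by positivity)]
      linarith
    calc ‖S t‖ ≤ C * t ^ α := hC t ht
      _ ≤ C * ((α + 1) * 2 * Real.exp (t / ((α + 1) * 2))) ^ α := by gcongr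
      _ = C * ((α + 1) * 2) ^ α * Real.exp (t / ((α + 1) * 2) * α) := by
        rw [Real.mul_rpow (by positivity) (by positivity), ← Real.exp_mul, mul_assoc]
      _ ≤ max ‖S 0‖ (C * ((α + 1) * 2) ^ α) * Real.exp (1 / 2 * t) := by
        refine mul_le_mul (le_max_right _ _) (Real.exp_le_exp.2 ?_) (by positivity) (by positivity)
        rw [div_mul_eq_mul_div, div_le_iff₀ (by positivity)]
        nlinarith
  · simp

end Generator

theorem theorem5p4 {X : Type*} [NormedAddCommGroup X] [NormedSpace ℂ X] [CompleteSpace X]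
    (α : ℝ) (hα : 0 ≤ α) (S : ℝ → X →L[ℂ] X) (hS : IsIntegratedSemigroup α S)
    (A : X →ₗ.[ℂ] X) (hA : IsGeneratorOf A α S) :
    (∀ C ω : ℝ, 0 ≤ ω → ω < 1 → (∀ t ≥ 0, ‖S t‖ ≤ C * Real.exp (ω * t)) →
      (1 : ℂ) ∈ opResolventSet A ∧
      (∀ (n : ℕ) (x : X), IntegrableOn (laplaceIntegrand S n x) (Ioi 0)) ∧
      (∀ (n : ℕ) (x : X),
        ∃ h : (∫ t in Ioi (0 : ℝ), laplaceIntegrand S n x t) ∈ A.domain,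
          cesaroSum α (opResolvent A 1) n x =
            (∫ t in Ioi (0 : ℝ), laplaceIntegrand S n x t) -
              A ⟨∫ t in Ioi (0 : ℝ), laplaceIntegrand S n x t, h⟩) ∧
      (∀ n : ℕ, 1 ≤ n → ∀ x : X,
        cesaroSum α (opResolvent A 1) n x =
          (∫ t in Ioi (0 : ℝ), laplaceIntegrand S (n - 1) x t) +
            ((cesaroNumber (α + 1) n : ℝ) : ℂ) • x -
            ((cesaroNumber (α + 1) (n - 1) : ℝ) : ℂ) • x)) ∧
    (∀ C : ℝ, (∀ t > 0, ‖S t‖ ≤ C * t ^ α) →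
      (1 : ℂ) ∈ opResolventSet A ∧ IsCesaroBounded α (opResolvent A 1)) := by
  have hcont := hS.continuousOn
  have hformula (C ω : ℝ) (hω : 0 ≤ ω) (hω1 : ω < 1)
      (hb : ∀ t ≥ 0, ‖S t‖ ≤ C * Real.exp (ω * t)) (n : ℕ) (x : X) :
      cesaroSum α (opResolvent A 1) (n + 1) x =
        (∫ t in Ioi (0 : ℝ), laplaceIntegrand S n x t) +
          ((cesaroNumber α (n + 1) : ℝ) : ℂ) • x := by
    rw [hA.integral_laplaceIntegrand hα hcont hω hω1 hb, cesaroSum_succ,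
      ← (commute_cesaroSum (opResolvent A 1) n).eq, add_comm]
    simp
  refine ⟨fun C ω hω hω1 hb => ?_, fun C hC => ?_⟩
  · have hmem := (hA.isResolventAt hcont hω hb (z := 1) (by simpa using hω1)).1
    refine ⟨hmem, fun n x => ?_, fun n x => ?_, fun n hn x => ?_⟩
    · rw [← laplaceKernel_one]
      exact integrableOn_laplaceKernel hcont hb (by simpa using hω1) n x
    · rw [hA.integral_laplaceIntegrand hα hcont hω hω1 hb]
      obtain ⟨h, e⟩ := (isResolventAt_opResolvent hmem).1 (cesaroSum α (opResolvent A 1) n x)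
      exact ⟨h, by rw [one_smul] at e; exact e.symm⟩
    · obtain ⟨n, rfl⟩ := Nat.exists_eq_succ_of_ne_zero (Nat.one_le_iff_ne_zero.1 hn)
      rw [Nat.succ_eq_add_one, hformula C ω hω hω1 hb, ← cesaroNumber_add_one_sub hα,
        Complex.ofReal_sub, sub_smul, Nat.add_sub_cancel, add_sub_assoc]
  · obtain ⟨C', hb⟩ := exists_norm_le_exp_of_rpow hα hC
    refine ⟨(hA.isResolventAt hcont (by norm_num) hb (z := 1) (by norm_num)).1, ?_⟩
    have hC0 : 0 ≤ C := by simpa using (norm_nonneg _).trans (hC 1 one_pos)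
    have hG : 0 ≤ Real.Gamma (α + 1) := Real.Gamma_nonneg_of_nonneg (by positivity)
    -- The integral contributes `C Γ(α+1)`, as `k^{α+1}` is nondecreasing; the scalar term
    -- contributes `1`, as `k^α(n+1) ≤ k^{α+1}(n+1)`.
    refine ⟨C * Real.Gamma (α + 1) + 1, ?_⟩
    rintro _ ⟨n, rfl⟩
    have hk := cesaroNumber_add_one_pos hα n
    refine ContinuousLinearMap.opNorm_le_bound _ (by positivity) fun x => ?_
    rw [smul_apply, norm_smul, Complex.norm_real,
      Real.norm_of_nonneg (by positivity), one_div, inv_mul_le_iff₀ hk]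
    cases n with
    | zero =>
      rw [cesaroSum_zero hα, cesaroNumber_zero (by positivity), one_mul]
      have : 0 ≤ C * Real.Gamma (α + 1) * ‖x‖ := by positivity
      simp only [one_apply_eq_self]
      linarith
    | succ n =>
      rw [hformula C' (1 / 2) (by norm_num) (by norm_num) hb]
      have h0 := cesaroNumber_nonneg hα (n + 1)
      have h1 := cesaroNumber_add_one_sub hα n
      have h2 := cesaroNumber_add_one_pos hα n
      calc _ ≤ C * Real.Gamma (α + 1) * cesaroNumber (α + 1) n * ‖x‖ +
            cesaroNumber α (n + 1) * ‖x‖ := by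
            refine (norm_add_le _ _).trans (add_le_add
              (norm_integral_laplaceIntegrand_le hα hC n x) ?_)
            rw [norm_smul, Complex.norm_real, Real.norm_of_nonneg h0]
        _ ≤ C * Real.Gamma (α + 1) * cesaroNumber (α + 1) (n + 1) * ‖x‖ +
            cesaroNumber (α + 1) (n + 1) * ‖x‖ := by
            gcongr <;> linarith
        _ = _ := by ring
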